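/- All graphs are finite and simple. For graphs $F$ and $G$ let $\hom(F,G)$ be the number of homomorphisms (adjacency-preserving vertex maps) from $F$ to $G$. A family $\mathcal{F}$ of graphs is *homomorphism distinguishing closed* if for every graph $F \notin \mathcal{F}$ there are graphs $G$ and $H$ such that $\hom(F',G) = \hom(F',H)$ for all $F' \in \mathcal{F}$ but $\hom(F,G) \neq \hom(F,H)$. Let $R$ be a graph and let $c : V(R) \to \{0,1\}$ and $\ell : V(R) \to \{i \in \mathbb{N} : i \geq 3\}$. A graph $F$ *contains an $(R,c,\ell)$ cycle structure* if there are pairwise distinct cycles $C_u$ in $F$, for $u \in V(R)$, such that $C_u$ has length at least $\ell(u)$ and of the same parity as $\ell(u)$, $C_u$ is chordless (induced) in $F$ if $c(u) = 1$, and $C_u$ and $C_v$ are vertex-disjoint whenever $u$ and $v$ are adjacent in $R$. Then the following hold. 1. For all $R$, $c$ and $\ell$ as above, the family of graphs $F$ such that no connected component of $F$ contains an $(R,c,\ell)$ cycle structure is homomorphism distinguishing closed. 2. For every $k \in \mathbb{N}$ with $k \geq 3$, the family of graphs of circumference at most $k$ is homomorphism distinguishing closed, where the circumference is the maximum length of a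 cycle (and a graph without cycles has circumference $0$). 3. The family of all forests is homomorphism distinguishing closed. 4. The family of graphs that contain no odd hole (induced odd cycle of length at least $5$) is homomorphism distinguishing closed. -/

import Mathlib

/-- A finite simple graph, bundled with its vertex type. Every finite simple graph is isomorphic
to one whose vertex type lives in `Type`. -/
structure FinGraph where
  /-- the vertex set -/
  V : Type
  [finite : Finite V]
  /-- the adjacency relation -/
  graph : SimpleGraph V

namespace FinGraph

/-- `hom(F, G)`: the number of homomorphisms from `F` to `G`. -/
noncomputable def hom (F G : FinGraph) : ℕ :=
  Nat.card (F.graph →g G.graph)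

/-- `G` and `H` are homomorphism indistinguishable over the family `𝓕`. -/
def HomIndistinguishable (𝓕 : Set FinGraph) (G H : FinGraph) : Prop :=
  ∀ F ∈ 𝓕, F.hom G = F.hom H

/-- The family `𝓕` is homomorphism distinguishing closed: every graph outside `𝓕` has different
numbers of homomorphisms to some two graphs that are homomorphism indistinguishable over `𝓕`. -/
def IsHomDistinguishingClosed (𝓕 : Set FinGraph) : Prop :=
  ∀ F : FinGraph, F ∉ 𝓕 → ∃ G H : FinGraph, HomIndistinguishable 𝓕 G H ∧ F.hom G ≠ F.hom H

end FinGraph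

/-- `G` contains an `(R, c, ℓ)` cycle structure. The cycles are given as closed walks; they are
distinct as cycles (not merely as closed walks), that is, their subgraphs are distinct. -/
def ContainsCycleStructure {V W : Type*} (G : SimpleGraph V) (R : SimpleGraph W)
    (c : W → Fin 2) (ℓ : W → ℕ) : Prop :=
  ∃ (x : W → V) (C : ∀ u, G.Walk (x u) (x u)),
    (∀ u, (C u).IsCycle) ∧
    (∀ u v, u ≠ v → (C u).toSubgraph ≠ (C v).toSubgraph) ∧
    (∀ u, ℓ u ≤ (C u).length ∧ (C u).length ≡ ℓ u [MOD 2]) ∧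
    (∀ u, c u = 1 → (C u).IsChordless) ∧
    (∀ u v, R.Adj u v → (C u).support.Disjoint (C v).support)

/-- The maximum length of a cycle in `G` (`0` if there is no cycle, `⊤` if lengths of cycles
are unbounded, which does not happen in a finite graph). -/
noncomputable def circumference {V : Type*} (G : SimpleGraph V) : ℕ∞ :=
  ⨆ (v : V) (C : G.Walk v v) (_ : C.IsCycle), (C.length : ℕ∞)

/-- `G` contains an odd hole: an induced odd cycle of length at least `5`. -/
def HasOddHole {V : Type*} (G : SimpleGraph V) : Prop :=
  ∃ (v : V) (C : G.Walk v v), C.IsCycle ∧ 5 ≤ C.length ∧ Odd C.length ∧ C.IsChordless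

/-! Given `F` outside the family, compare the Cai–Fürer–Immerman graphs of `F` with charge zero and
with charge one at a vertex `v₀` of a component `K` containing the structure. Homomorphisms into
them are maps `φ` to `F` with an edge labelling over `ZMod 2` (`homCfiEquiv`), and labellings with a
given charge, if any exist, are a translate of those with charge zero. So the counts agree when
every `φ` lifts, and differ for `F` because the identity does not (`not_isLift_id`). If some `φ`
from a component of `F'` fails to lift, the charge can be moved within `K`, so it fails at every
vertex of `K`. Then over each cycle of `K` there is a cycle winding around it an odd number of times
(`exists_isCycle_over`), and these cycles form the same structure in `F'`. -/

/-! ### Closed walks of odd weight -/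

namespace SimpleGraph.Walk

variable {V : Type*} {G : SimpleGraph V}

/-- The total weight, modulo two, of the edges traversed by a walk. -/
def weight (w : Sym2 V → ZMod 2) {u v : V} (p : G.Walk u v) : ZMod 2 :=
  (p.edges.map w).sum

@[simp] lemma weight_nil (w : Sym2 V → ZMod 2) (u : V) : (nil : G.Walk u u).weight w = 0 := by
  simp [weight]

@[simp] lemma weight_cons (w : Sym2 V → ZMod 2) {u v x : V} (h : G.Adj u v) (p : G.Walk v x) :
    (cons h p).weight w = w s(u, v) + p.weight w := by
  simp [weight]

@[simp] lemma weight_append (w : Sym2 V → ZMod 2) {u v x : V} (p : G.Walk u v) (q : G.Walk v x) :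
    (p.append q).weight w = p.weight w + q.weight w := by
  simp [weight]

@[simp] lemma weight_reverse (w : Sym2 V → ZMod 2) {u v : V} (p : G.Walk u v) :
    p.reverse.weight w = p.weight w := by
  simp [weight, List.sum_reverse]

/-- The potential of a vertex is the weight of any walk to it from a root of its component. -/
lemma exists_potential (w : Sym2 V → ZMod 2) (h : ∀ v (p : G.Walk v v), p.weight w = 0) :
    ∃ f : V → ZMod 2, ∀ a b, G.Adj a b → f a + f b = w s(a, b) := by
  have hr : ∀ a, Nonempty (G.Walk (G.connectedComponentMk a).out a) := fun a =>
    ConnectedComponent.exact (Quot.out_eq (G.connectedComponentMk a))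
  refine ⟨fun a => (hr a).some.weight w, fun a b hab => ?_⟩
  have key : ∀ x y, x = y → ∀ (p : G.Walk x a) (q : G.Walk y b),
      p.weight w + q.weight w = w s(a, b) := by
    rintro x _ rfl p q
    have := h x (p.append (cons hab q.reverse))
    simp only [weight_append, weight_cons, weight_reverse] at this
    generalize p.weight w = i, q.weight w = j, w s(a, b) = k at *
    revert i j k; decide
  exact key _ _ (by rw [ConnectedComponent.connectedComponentMk_eq_of_adj hab]) _ _

/-- A shortest closed walk of odd weight is a chordless cycle. -/
theorem exists_isCycle_isChordless_of_weight_ne_zero (w : Sym2 V → ZMod 2) {v : V}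
    (p : G.Walk v v) (hp : p.weight w ≠ 0) :
    ∃ (u : V) (q : G.Walk u u), q.IsCycle ∧ q.IsChordless ∧ q.weight w ≠ 0 := by
  classical
  have hex : ∃ n, ∃ (u : V) (q : G.Walk u u), q.weight w ≠ 0 ∧ q.length = n := ⟨_, v, p, hp, rfl⟩
  obtain ⟨u, q, hq, hlen⟩ := Nat.find_spec hex
  have hmin : ∀ x (r : G.Walk x x), r.length < q.length → r.weight w = 0 := by
    intro x r hr
    by_contra hne
    exact Nat.find_min hex (hlen ▸ hr) ⟨x, r, hne, rfl⟩
  refine ⟨u, q, ?_, ?_, hq⟩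
  · cases q with
    | nil => simp at hq
    | cons h q =>
      rename_i b
      have hpath : q.IsPath := by
        rw [isPath_iff_isSubwalk_imp_nil]
        rintro x r ⟨s, t, rfl⟩
        by_contra hnil
        have hpos : 0 < r.length := by
          rwa [Nat.pos_iff_ne_zero, ne_eq, length_eq_zero_iff]
        -- A repeated vertex would split the walk into two shorter closed walks whose weights add up
        -- to an odd one.
        have h1 := hmin _ (cons h (s.append t)) (by simp; omega)
        have h2 := hmin _ r (by simp; omega)
        simp only [weight_cons, weight_append] at h1 h2 hq
        rw [h2, add_zero] at hq
        exact hq h1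
      refine (cons_isCycle_iff q h).2 ⟨hpath, fun hmem => hq ?_⟩
      rw [Sym2.eq_swap] at hmem
      rw [hpath.eq_adj_toWalk_of_mem_edges hmem]
      simp [Adj.toWalk, Sym2.eq_swap (a := b), CharTwo.add_self_eq_zero]
  · rw [isChordless_iff_forall_mem_edges]
    intro a b ha hb hab
    by_contra hmem
    have hb' : b ∈ (q.rotate a ha).support := (mem_support_rotate_iff ..).2 hb
    have hlen' : (q.rotate a ha).length = q.length := length_rotate ..
    have hmem' : s(a, b) ∉ (q.rotate a ha).edges := fun hc =>
      hmem ((rotate_edges q a ha).mem_iff.1 hc)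
    have hw' : (q.rotate a ha).weight w = q.weight w := by
      unfold weight
      exact ((rotate_edges q a ha).perm.map w).sum_eq
    generalize q.rotate a ha = r at *
    obtain ⟨s, t, rfl⟩ := mem_support_iff_exists_append.1 hb'
    have hlong : ∀ {x y : V} (z : G.Walk x y), x ≠ y → s(x, y) ∉ z.edges → 1 < z.length := by
      intro x y z hxy hz
      cases z with
      | nil => exact absurd rfl hxy
      | cons h z =>
        cases z with
        | nil => simp at hz
        | cons => simp
    simp only [edges_append, List.mem_append, not_or] at hmem'
    -- Both arcs have length at least two, so each closed up by the chord is shorter than `q`; the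
    -- chord counts twice and cancels.
    have hs := hlong s hab.ne hmem'.1
    have ht := hlong t hab.ne' (by rw [Sym2.eq_swap]; exact hmem'.2)
    rw [length_append] at hlen'
    have h1 := hmin _ (cons hab.symm s) (by rw [length_cons]; omega)
    have h2 := hmin _ (cons hab t) (by rw [length_cons]; omega)
    rw [← hw'] at hq
    rw [weight_append] at hq
    rw [weight_cons] at h1 h2
    rw [Sym2.eq_swap] at h1
    generalize s.weight w = i, t.weight w = j, w s(a, b) = k at *
    revert i j k; decide

end SimpleGraph.Walk

/-! ### Closed walks along a cycle, modulo two -/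

namespace SimpleGraph.Walk

variable {V : Type*} {G : SimpleGraph V}

lemma toSubgraph_eq_iff_of_not_nil {u v : V} {p : G.Walk u u} {q : G.Walk v v} (hp : ¬ p.Nil)
    (hq : ¬ q.Nil) : p.toSubgraph = q.toSubgraph ↔ ∀ e, e ∈ p.edges ↔ e ∈ q.edges := by
  constructor
  · intro h e
    rw [← mem_edges_toSubgraph, h, mem_edges_toSubgraph]
  · intro h
    ext x y
    · rw [mem_verts_toSubgraph, mem_verts_toSubgraph, mem_support_iff_exists_mem_edges_of_not_nil hp,
        mem_support_iff_exists_mem_edges_of_not_nil hq]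
      simp only [h]
    · rw [adj_toSubgraph_iff_mem_edges, adj_toSubgraph_iff_mem_edges, h]

/-- Modulo two, a walk traverses edges at a vertex `c` as often as `c` is one of its ends. -/
lemma sum_count_edges [Fintype V] [DecidableEq V] (c : V) {u v : V} (p : G.Walk u v) :
    ∑ x, (p.edges.count s(c, x) : ZMod 2) =
      (if u = c then 1 else 0) + (if v = c then 1 else 0) := by
  induction p with
  | nil => simp [CharTwo.add_self_eq_zero]
  | @cons a b d h p ih =>
    have key : ∑ x, (if s(a, b) = s(c, x) then 1 else 0 : ZMod 2) =
        (if a = c then 1 else 0) + (if b = c then 1 else 0) := by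
      by_cases hac : a = c
      · subst hac
        simp [h.ne']
      · by_cases hbc : b = c
        · subst hbc
          simp [hac]
        · simp [hac, hbc]
    simp only [edges_cons, List.count_cons, Nat.cast_add, Finset.sum_add_distrib, ih, beq_iff_eq,
      Nat.cast_ite, Nat.cast_one, Nat.cast_zero, key]
    generalize (if a = c then 1 else 0 : ZMod 2) = i, (if b = c then 1 else 0 : ZMod 2) = j,
      (if d = c then 1 else 0 : ZMod 2) = k
    revert i j k; decide

/-- A closed walk along the edges of a cycle traverses all of them equally often modulo two. -/
lemma IsCycle.count_edges_eq [Finite V] [DecidableEq V] {u v : V} {C : G.Walk u u}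
    (hC : C.IsCycle) (p : G.Walk v v) (hp : p.edges ⊆ C.edges) {e e' : Sym2 V}
    (he : e ∈ C.edges) (he' : e' ∈ C.edges) :
    (p.edges.count e : ZMod 2) = p.edges.count e' := by
  have := Fintype.ofFinite V
  have key : ∀ i, i < C.length → (p.edges.count s(C.getVert i, C.getVert (i + 1)) : ZMod 2) =
      p.edges.count s(C.getVert 0, C.getVert 1) := by
    intro i
    induction i with
    | zero => intro; rfl
    | succ i ih =>
      intro hi
      rw [← ih (by omega)]
      have hsum := sum_count_edges (C.getVert (i + 1)) p
      have hnb := hC.neighborSet_toSubgraph_internal (Nat.succ_ne_zero i) hi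
      have hne := hC.getVert_sub_one_ne_getVert_add_one hi.le
      simp only [Nat.add_sub_cancel] at hnb hne
      -- Only two edges of `C` meet this vertex and their counts sum to zero, so the counts agree.
      rw [CharTwo.add_self_eq_zero, ← Finset.sum_subset
        (Finset.subset_univ {C.getVert i, C.getVert (i + 1 + 1)}), Finset.sum_pair hne] at hsum
      · rw [Sym2.eq_swap (a := C.getVert i)]
        exact (CharTwo.add_eq_zero.1 hsum).symm
      · intro x _ hx
        have hx' : x ∉ C.toSubgraph.neighborSet (C.getVert (i + 1)) := by
          rw [hnb]; simpa using hx
        rw [Subgraph.mem_neighborSet, adj_toSubgraph_iff_mem_edges] at hx'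
        rw [List.count_eq_zero_of_not_mem fun h => hx' (hp h), Nat.cast_zero]
  have h0 : ∀ e ∈ C.edges, (p.edges.count e : ZMod 2) =
      p.edges.count s(C.getVert 0, C.getVert 1) := by
    intro e he
    induction e with
    | _ x y =>
      obtain ⟨i, hi, hxy⟩ := (mk_mem_edges_iff_exists C).1 he
      rw [← hxy, key i hi]
  rw [h0 e he, h0 e' he']

lemma IsCycle.length_of_odd_count [DecidableEq V] {u v : V} {C : G.Walk u u}
    (hC : C.IsCycle) (p : G.Walk v v) (hp : p.edges ⊆ C.edges)
    (hodd : ∀ e ∈ C.edges, (p.edges.count e : ZMod 2) = 1) :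
    C.edges ⊆ p.edges ∧ C.length ≤ p.length ∧ p.length ≡ C.length [MOD 2] := by
  have hsub : C.edges ⊆ p.edges := by
    intro e he
    by_contra hne
    have := hodd e he
    rw [List.count_eq_zero_of_not_mem hne] at this
    simp at this
  refine ⟨hsub, ?_, ?_⟩
  · rw [← length_edges, ← length_edges]
    exact (hC.edges_nodup.subperm hsub).length_le
  · rw [← ZMod.natCast_eq_natCast_iff, ← length_edges, ← length_edges]
    have h1 : ∑ e ∈ C.edges.toFinset, p.edges.count e = p.edges.length := by
      simpa using Multiset.sum_count_eq_card (m := (p.edges : Multiset (Sym2 V)))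
        (s := C.edges.toFinset) fun a ha => List.mem_toFinset.2 (hp ha)
    rw [← h1, Nat.cast_sum, Finset.sum_congr rfl fun e he => hodd e (List.mem_toFinset.1 he),
      Finset.sum_const, List.toFinset_card_of_nodup hC.edges_nodup, nsmul_one]

end SimpleGraph.Walk

/-! ### Cai–Fürer–Immerman graphs and liftings -/

namespace SimpleGraph

variable {A V : Type*} {Γ : SimpleGraph A} {G : SimpleGraph V} [Fintype V]

/-- `x` is the edge labelling of a homomorphism to the Cai–Fürer–Immerman graph of `G` with
charge `q` that lies over `φ`. -/
structure IsLift (φ : Γ →g G) (q : V → ZMod 2) (x : A → V → ZMod 2) : Prop where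
  eq_zero : ∀ a v, ¬ G.Adj (φ a) v → x a v = 0
  sum_eq : ∀ a, ∑ v, x a v = q (φ a)
  symm : ∀ a b, Γ.Adj a b → x a (φ b) = x b (φ a)

lemma IsLift.add {φ : Γ →g G} {q r : V → ZMod 2} {x y : A → V → ZMod 2} (hx : IsLift φ q x)
    (hy : IsLift φ r y) : IsLift φ (q + r) (x + y) where
  eq_zero a v h := by simp [hx.eq_zero a v h, hy.eq_zero a v h]
  sum_eq a := by simp [Finset.sum_add_distrib, hx.sum_eq, hy.sum_eq]
  symm a b h := by simp [hx.symm a b h, hy.symm a b h]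

/-- The Cai–Fürer–Immerman graph of `G` with charge `q`. -/
def cfi (G : SimpleGraph V) (q : V → ZMod 2) :
    SimpleGraph {y : V × (V → ZMod 2) // (∀ v, ¬ G.Adj y.1 v → y.2 v = 0) ∧ ∑ v, y.2 v = q y.1}
    where
  Adj y z := G.Adj y.1.1 z.1.1 ∧ y.1.2 z.1.1 = z.1.2 y.1.1
  symm := ⟨fun _ _ h => ⟨h.1.symm, h.2.symm⟩⟩
  loopless := ⟨fun _ h => h.1.ne rfl⟩

/-- Homomorphisms to a Cai–Fürer–Immerman graph are homomorphisms to the base graph together with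
a labelling. -/
def homCfiEquiv (Γ : SimpleGraph A) (G : SimpleGraph V) (q : V → ZMod 2) :
    (Γ →g cfi G q) ≃ Σ φ : Γ →g G, {x : A → V → ZMod 2 // IsLift φ q x} where
  toFun f := ⟨⟨fun a => (f a).1.1, fun h => (f.map_adj h).1⟩, fun a => (f a).1.2,
    fun a => (f a).2.1, fun a => (f a).2.2, fun _ _ h => (f.map_adj h).2⟩
  invFun g := ⟨fun a => ⟨(g.1 a, g.2.1 a), g.2.2.eq_zero a, g.2.2.sum_eq a⟩,
    fun {a b} h => ⟨g.1.map_adj h, g.2.2.symm a b h⟩⟩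
  left_inv _ := rfl
  right_inv _ := rfl

/-- Translation of labellings by a fixed one. -/
def IsLift.equiv {φ : Γ →g G} {q : V → ZMod 2} {x : A → V → ZMod 2} (hx : IsLift φ q x) :
    {y : A → V → ZMod 2 // IsLift φ 0 y} ≃ {y : A → V → ZMod 2 // IsLift φ q y} where
  toFun y := ⟨y.1 + x, by simpa using y.2.add hx⟩
  invFun y := ⟨y.1 + x, by
    have := y.2.add hx
    rwa [show q + q = 0 from funext fun v => CharTwo.add_self_eq_zero (q v)] at this⟩
  left_inv y := by ext; simp [add_assoc, CharTwo.add_self_eq_zero]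
  right_inv y := by ext; simp [add_assoc, CharTwo.add_self_eq_zero]

lemma isLift_zero (φ : Γ →g G) : IsLift φ 0 0 := ⟨by simp, by simp, by simp⟩

lemma card_hom_cfi_eq {q : V → ZMod 2} (h : ∀ φ : Γ →g G, ∃ x, IsLift φ q x) :
    Nat.card (Γ →g cfi G 0) = Nat.card (Γ →g cfi G q) :=
  Nat.card_congr <| (homCfiEquiv Γ G 0).trans <|
    (Equiv.sigmaCongrRight fun φ => (h φ).choose_spec.equiv).trans (homCfiEquiv Γ G q).symm

lemma card_hom_cfi_lt [Finite A] {q : V → ZMod 2} {φ₀ : Γ →g G} (h : ¬ ∃ x, IsLift φ₀ q x) :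
    Nat.card (Γ →g cfi G q) < Nat.card (Γ →g cfi G 0) := by
  have : Finite (Γ →g G) := Finite.of_injective _ DFunLike.coe_injective
  have := Fintype.ofFinite (Γ →g G)
  rw [Nat.card_congr (homCfiEquiv Γ G q), Nat.card_congr (homCfiEquiv Γ G 0), Nat.card_sigma,
    Nat.card_sigma]
  refine Finset.sum_lt_sum (fun φ _ => ?_) ⟨φ₀, Finset.mem_univ _, ?_⟩
  · by_cases hφ : ∃ x, IsLift φ q x
    · exact (Nat.card_congr hφ.choose_spec.equiv).ge
    · have : IsEmpty {x : A → V → ZMod 2 // IsLift φ q x} := ⟨fun x => hφ ⟨x.1, x.2⟩⟩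
      simp
  · have : IsEmpty {x : A → V → ZMod 2 // IsLift φ₀ q x} := ⟨fun x => h ⟨x.1, x.2⟩⟩
    have : Nonempty {x : A → V → ZMod 2 // IsLift φ₀ 0 x} := ⟨⟨0, isLift_zero φ₀⟩⟩
    rw [Nat.card_of_isEmpty]
    exact Nat.card_pos

/-- Handshake argument: over the identity a labelling is symmetric with zero diagonal, so its total
is even, whereas the total charge is one. -/
lemma not_isLift_id [DecidableEq V] (v₀ : V) (x : V → V → ZMod 2) :
    ¬ IsLift (Hom.id : G →g G) (Pi.single v₀ 1) x := by
  intro hx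
  have hsymm : ∀ a b, x a b = x b a := by
    intro a b
    by_cases h : G.Adj a b
    · exact hx.symm a b h
    · rw [hx.eq_zero a b h, hx.eq_zero b a fun h' => h h'.symm]
  have h1 : ∑ p : V × V, x p.1 p.2 = 1 := by
    rw [Fintype.sum_prod_type]
    simp [hx.sum_eq]
  have h0 : ∑ p : V × V, x p.1 p.2 = 0 := by
    refine Finset.sum_involution (fun p _ => p.swap) ?_ ?_ (by simp) (by simp)
    · rintro ⟨a, b⟩ -
      simp [hsymm a b, CharTwo.add_self_eq_zero]
    · rintro ⟨a, b⟩ - hne heq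
      simp only [Prod.swap_prod_mk, Prod.mk.injEq] at heq
      obtain ⟨rfl, -⟩ := heq
      exact hne (hx.eq_zero _ _ (G.loopless.irrefl _))
  exact one_ne_zero (h1.symm.trans h0)

lemma exists_isLift_single_of_adj [DecidableEq V] {φ : Γ →g G} {u v : V} (huv : G.Adj u v)
    (h : ∃ x, IsLift φ (Pi.single u 1) x) : ∃ x, IsLift φ (Pi.single v 1) x := by
  obtain ⟨x, hx⟩ := h
  -- The indicator of the edge `uv`, pulled back along `φ`, shifts the charge from `u` to `v`.
  have hy : IsLift φ (Pi.single u 1 + Pi.single v 1)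
      (fun a w => if s(φ a, w) = s(u, v) then 1 else 0) := by
    refine ⟨fun a w h => if_neg fun h' => h ?_, fun a => ?_, fun a b _ => ?_⟩
    · rwa [← mem_edgeSet, h']
    · have := Walk.sum_count_edges (φ a) huv.toWalk
      simp only [Adj.toWalk, Walk.edges_cons, Walk.edges_nil, List.count_singleton, beq_iff_eq,
        Nat.cast_ite, Nat.cast_one, Nat.cast_zero] at this
      simpa [Pi.single_apply, eq_comm] using this
    · rw [Sym2.eq_swap]
  have := hx.add hy
  rw [← add_assoc, ← Pi.single_add, CharTwo.add_self_eq_zero, Pi.single_zero, zero_add] at this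
  exact ⟨_, this⟩

lemma Reachable.exists_isLift_single [DecidableEq V] {φ : Γ →g G} {u v : V}
    (huv : G.Reachable u v) (h : ∃ x, IsLift φ (Pi.single u 1) x) :
    ∃ x, IsLift φ (Pi.single v 1) x := by
  obtain ⟨p⟩ := huv
  induction p with
  | nil => exact h
  | cons hadj _ ih => exact ih (exists_isLift_single_of_adj hadj h)

lemma exists_isLift_of_connectedComponent {φ : Γ →g G} {q : V → ZMod 2}
    (h : ∀ K : Γ.ConnectedComponent, ∃ x, IsLift (φ.comp K.toSimpleGraph_hom) q x) :
    ∃ x, IsLift φ q x := by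
  choose x hx using h
  have key : ∀ (K L : Γ.ConnectedComponent) (a : A) (hK : a ∈ K) (hL : a ∈ L),
      x K ⟨a, hK⟩ = x L ⟨a, hL⟩ := by
    rintro K L a rfl rfl
    rfl
  refine ⟨fun a => x (Γ.connectedComponentMk a) ⟨a, rfl⟩, fun a => (hx _).eq_zero ⟨a, rfl⟩,
    fun a => (hx _).sum_eq ⟨a, rfl⟩, fun a b hab => ?_⟩
  have hb : b ∈ Γ.connectedComponentMk a :=
    (ConnectedComponent.connectedComponentMk_eq_of_adj hab).symm
  rw [key (Γ.connectedComponentMk b) (Γ.connectedComponentMk a) b rfl hb]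
  exact (hx (Γ.connectedComponentMk a)).symm ⟨a, rfl⟩ ⟨b, hb⟩ hab

/-! ### Cycles winding around a cycle -/

/-- If the charge at a vertex of a cycle `C` of `G` cannot be lifted along `φ`, then some cycle
wraps around `C` an odd number of times. -/
theorem exists_isCycle_over [DecidableEq V] (φ : Γ →g G) {v : V} (C : G.Walk v v)
    (hC : C.IsCycle) (h : ¬ ∃ x, IsLift φ (Pi.single v 1) x) :
    ∃ (a : A) (D : Γ.Walk a a), D.IsCycle ∧ (∀ e, e ∈ (D.map φ).edges ↔ e ∈ C.edges) ∧
      C.length ≤ D.length ∧ D.length ≡ C.length [MOD 2] ∧ (C.IsChordless → D.IsChordless) := by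
  let H : SimpleGraph A :=
    { Adj := fun a b => Γ.Adj a b ∧ s(φ a, φ b) ∈ C.edges
      symm := ⟨fun a b h => ⟨h.1.symm, by rw [Sym2.eq_swap]; exact h.2⟩⟩
      loopless := ⟨fun a h => h.1.ne rfl⟩ }
  have hle : H ≤ Γ := fun a b h => h.1
  have hsnd : s(v, C.snd) ∈ C.edges := C.mk_start_snd_mem_edges hC.not_nil
  have hvs : G.Adj v C.snd := C.adj_snd hC.not_nil
  have hHC : ∀ {a b : A} (D : H.Walk a b), ((D.mapLe hle).map φ).edges ⊆ C.edges := by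
    intro a b D e he
    rw [Walk.edges_map, Walk.edges_mapLe_eq_edges, List.mem_map] at he
    obtain ⟨f, hf, rfl⟩ := he
    induction f with
    | _ a b => exact (D.adj_of_mem_edges hf).2
  -- Counting passages over one edge of `C` suffices, since a closed walk over `C` passes all its
  -- edges equally often modulo two.
  let w : Sym2 A → ZMod 2 := fun e => if Sym2.map φ e = s(v, C.snd) then 1 else 0
  have hex : ∃ (a : A) (D : H.Walk a a), D.weight w ≠ 0 := by
    by_contra! hall
    obtain ⟨f, hf⟩ := Walk.exists_potential w hall
    refine h ⟨fun a y => if s(φ a, y) ∈ C.edges then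
      f a + (if φ a = v ∧ y = C.snd then 1 else 0) else 0, fun a y hay => if_neg fun hmem => ?_,
      fun a => ?_, fun a b hab => ?_⟩
    · exact hay (C.adj_of_mem_edges hmem)
    · have h1 : ∀ y, (if s(φ a, y) ∈ C.edges then
          f a + (if φ a = v ∧ y = C.snd then 1 else 0) else 0 : ZMod 2) =
          C.edges.count s(φ a, y) * f a +
            (if y = C.snd then (if φ a = v then 1 else 0) else 0) := by
        intro y
        by_cases hmem : s(φ a, y) ∈ C.edges
        · rw [if_pos hmem, List.count_eq_one_of_mem hC.edges_nodup hmem]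
          by_cases h1 : φ a = v <;> by_cases h2 : y = C.snd <;> simp [h1, h2]
        · rw [if_neg hmem, List.count_eq_zero_of_not_mem hmem]
          have : ¬ (y = C.snd ∧ φ a = v) := by
            rintro ⟨rfl, h2⟩
            exact hmem (h2 ▸ hsnd)
          by_cases h1 : φ a = v <;> by_cases h2 : y = C.snd <;> simp_all
      simp only [h1, Finset.sum_add_distrib, ← Finset.sum_mul, Walk.sum_count_edges,
        CharTwo.add_self_eq_zero, zero_mul, zero_add, Finset.sum_ite_eq', Finset.mem_univ, if_true,
        Pi.single_apply]
    · rw [Sym2.eq_swap (a := φ b)]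
      by_cases hmem : s(φ a, φ b) ∈ C.edges
      · rw [if_pos hmem, if_pos hmem]
        have h1 := hf a b ⟨hab, hmem⟩
        have h2 : w s(a, b) = (if φ a = v ∧ φ b = C.snd then 1 else 0) +
            (if φ b = v ∧ φ a = C.snd then 1 else 0) := by
          simp only [w, Sym2.map_mk, Sym2.eq_iff]
          by_cases h1 : φ a = v ∧ φ b = C.snd
          · simp [h1, hvs.ne]
          · simp [h1, and_comm]
        rw [h2] at h1
        generalize (if φ a = v ∧ φ b = C.snd then 1 else 0 : ZMod 2) = i,
          (if φ b = v ∧ φ a = C.snd then 1 else 0 : ZMod 2) = j, f a = k, f b = l at *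
        clear h2
        revert i j k l; decide
      · rw [if_neg hmem, if_neg hmem]
  obtain ⟨a, p, hp⟩ := hex
  obtain ⟨b, D, hD, hchord, hDw⟩ := Walk.exists_isCycle_isChordless_of_weight_ne_zero w p hp
  have hcount : ∀ e ∈ C.edges, (((D.mapLe hle).map φ).edges.count e : ZMod 2) = 1 := by
    intro e he
    rw [hC.count_edges_eq _ (hHC D) he hsnd]
    have hDw' : D.weight w = ((D.mapLe hle).map φ).edges.count s(v, C.snd) := by
      rw [Walk.edges_map, Walk.edges_mapLe_eq_edges, Walk.weight]
      induction D.edges with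
      | nil => simp
      | cons e l ih => simp [w, List.count_cons, ih, add_comm]
    rw [hDw'] at hDw
    generalize (((D.mapLe hle).map φ).edges.count s(v, C.snd) : ZMod 2) = i at *
    clear hDw'
    revert i; decide
  obtain ⟨h1, h2, h3⟩ := hC.length_of_odd_count _ (hHC D) hcount
  rw [Walk.length_map] at h2 h3
  refine ⟨b, D.mapLe hle, (Walk.isCycle_mapLe hle).2 hD,
    fun e => ⟨fun he => hHC D he, fun he => h1 he⟩, h2, h3, fun hCc => ?_⟩
  rw [Walk.isChordless_iff_forall_mem_edges] at hchord ⊢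
  rw [Walk.edges_mapLe_eq_edges, Walk.support_mapLe_eq_support]
  have hsupp : ∀ x ∈ D.support, φ x ∈ C.support := by
    intro x hx
    have hx' : φ x ∈ ((D.mapLe hle).map φ).support := by
      rw [Walk.support_map, Walk.support_mapLe_eq_support]
      exact List.mem_map_of_mem hx
    have hnil : ¬ ((D.mapLe hle).map φ).Nil := by
      rw [Walk.nil_map_iff, Walk.nil_map_iff]
      exact hD.not_nil
    obtain ⟨e, he, hxe⟩ := (Walk.mem_support_iff_exists_mem_edges_of_not_nil hnil).1 hx'
    exact (Walk.mem_support_iff_exists_mem_edges_of_not_nil hC.not_nil).2 ⟨e, hHC D he, hxe⟩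
  intro x y hx hy hxy
  -- As `C` is chordless, a chord of `D` in `Γ` would map to an edge of `C`, hence already be a
  -- chord in `H`.
  exact hchord hx hy ⟨hxy, hCc.mem_edges (hsupp x hx) (hsupp y hy) (φ.map_adj hxy)⟩

end SimpleGraph

/-! ### Cycles within components -/

namespace SimpleGraph

variable {V : Type*} {G : SimpleGraph V}

lemma ConnectedComponent.toSimpleGraph_hom_injective (K : G.ConnectedComponent) :
    Function.Injective K.toSimpleGraph_hom := Subtype.val_injective

lemma ConnectedComponent.isChordless_map_iff (K : G.ConnectedComponent) {u v : K}
    (p : K.toSimpleGraph.Walk u v) :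
    (p.map K.toSimpleGraph_hom).IsChordless ↔ p.IsChordless := by
  have hmem : ∀ a b : K, s((a : V), (b : V)) ∈ (p.map K.toSimpleGraph_hom).edges ↔
      s(a, b) ∈ p.edges := by
    intro a b
    rw [Walk.edges_map]
    exact List.mem_map_of_injective (Sym2.map.injective K.toSimpleGraph_hom_injective)
      (a := s(a, b))
  simp only [Walk.isChordless_iff_forall_mem_edges, Walk.support_map, List.mem_map]
  constructor
  · intro h a b ha hb hab
    exact (hmem a b).1 (h ⟨a, ha, rfl⟩ ⟨b, hb, rfl⟩ hab)
  · rintro h _ _ ⟨a, ha, rfl⟩ ⟨b, hb, rfl⟩ hab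
    exact (hmem a b).2 (h ha hb hab)

/-- A closed walk lies in a single connected component. -/
lemma Walk.exists_connectedComponent_walk {v : V} (p : G.Walk v v) :
    ∃ (K : G.ConnectedComponent) (u : K) (q : K.toSimpleGraph.Walk u u)
      (h : K.toSimpleGraph_hom u = v), (q.map K.toSimpleGraph_hom).copy h h = p := by
  classical
  exact ⟨G.connectedComponentMk v, _, p.induce (G.connectedComponentMk v).supp
    (fun _ hx => (ConnectedComponent.sound (p.takeUntil _ hx).reachable).symm), rfl,
    p.map_induce _⟩

end SimpleGraph

/-! ### Closedness of the families -/

namespace FinGraph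

open SimpleGraph

lemma isHomDistinguishingClosed_inter {𝓐 𝓑 : Set FinGraph} (hA : IsHomDistinguishingClosed 𝓐)
    (hB : IsHomDistinguishingClosed 𝓑) : IsHomDistinguishingClosed (𝓐 ∩ 𝓑) := by
  intro F hF
  by_cases h : F ∈ 𝓐
  · obtain ⟨G, H, h1, h2⟩ := hB F fun h' => hF ⟨h, h'⟩
    exact ⟨G, H, fun F' hF' => h1 F' hF'.2, h2⟩
  · obtain ⟨G, H, h1, h2⟩ := hA F h
    exact ⟨G, H, fun F' hF' => h1 F' hF'.1, h2⟩

/-- Cycle structures lift along homomorphisms that have no lift to the Cai–Fürer–Immerman graph. -/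
lemma containsCycleStructure_of_not_isLift {A V W : Type*} {Γ : SimpleGraph A} {G : SimpleGraph V}
    [Fintype V] [DecidableEq V] {R : SimpleGraph W} {c : W → Fin 2} {ℓ : W → ℕ} (φ : Γ →g G)
    (K : G.ConnectedComponent) (hK : ContainsCycleStructure K.toSimpleGraph R c ℓ)
    (h : ∀ v ∈ K, ¬ ∃ x, IsLift φ (Pi.single v 1) x) : ContainsCycleStructure Γ R c ℓ := by
  obtain ⟨x, C, hC, hne, hlen, hch, hdisj⟩ := hK
  have hinj := K.toSimpleGraph_hom_injective
  have hC' := fun u => (Walk.isCycle_map_iff_of_injective hinj).2 (hC u)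
  choose y D hD hDe hDl hDp hDc using fun u => exists_isCycle_over φ _ (hC' u) (h _ (x u).2)
  have hDs : ∀ u a, a ∈ (D u).support →
      φ a ∈ ((C u).map K.toSimpleGraph_hom).support := by
    intro u a ha
    have ha' : φ a ∈ ((D u).map φ).support := by
      rw [Walk.support_map]
      exact List.mem_map_of_mem ha
    have hnil : ¬ ((D u).map φ).Nil := by
      rw [Walk.nil_map_iff]
      exact (hD u).not_nil
    obtain ⟨e, he, hae⟩ := (Walk.mem_support_iff_exists_mem_edges_of_not_nil hnil).1 ha'
    exact (Walk.mem_support_iff_exists_mem_edges_of_not_nil (hC' u).not_nil).2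
      ⟨e, (hDe u e).1 he, hae⟩
  refine ⟨y, D, hD, fun u v huv heq => hne u v huv ?_, fun u => ?_, fun u hu => ?_,
    fun u v huv => ?_⟩
  -- The edges of `D u` map onto exactly those of `C u`, so equal lifted cycles have equal base
  -- cycles.
  · rw [Walk.toSubgraph_eq_iff_of_not_nil (hD u).not_nil (hD v).not_nil] at heq
    rw [Walk.toSubgraph_eq_iff_of_not_nil (hC u).not_nil (hC v).not_nil]
    intro e
    have h1 := hDe u (Sym2.map K.toSimpleGraph_hom e)
    have h2 := hDe v (Sym2.map K.toSimpleGraph_hom e)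
    simp only [Walk.edges_map, List.mem_map_of_injective (Sym2.map.injective hinj)] at h1 h2
    rw [← h1, ← h2]
    simp only [List.mem_map, heq]
  · have h1 := hDl u
    have h2 := hDp u
    rw [Walk.length_map] at h1 h2
    exact ⟨(hlen u).1.trans h1, h2.trans (hlen u).2⟩
  · exact hDc u ((K.isChordless_map_iff _).2 (hch u hu))
  · intro a ha hb
    have h1 := hDs u a ha
    have h2 := hDs v a hb
    rw [Walk.support_map, List.mem_map] at h1 h2
    obtain ⟨b, hb, hba⟩ := h1
    obtain ⟨b', hb', hba'⟩ := h2
    obtain rfl := hinj (hba.trans hba'.symm)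
    exact hdisj u v huv hb hb'

theorem isHomDistinguishingClosed_cycleStructure {W : Type*} (R : SimpleGraph W)
    (c : W → Fin 2) (ℓ : W → ℕ) : IsHomDistinguishingClosed
      {F | ∀ K : F.graph.ConnectedComponent, ¬ ContainsCycleStructure K.toSimpleGraph R c ℓ} := by
  classical
  intro F hF
  have := F.finite
  have := Fintype.ofFinite F.V
  simp only [Set.mem_ofPred_eq, not_forall, not_not] at hF
  obtain ⟨K, hK⟩ := hF
  obtain ⟨v₀, hv₀⟩ := K.nonempty_supp
  refine ⟨⟨_, cfi F.graph 0⟩, ⟨_, cfi F.graph (Pi.single v₀ 1)⟩, fun F' hF' => ?_,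
    (card_hom_cfi_lt (φ₀ := Hom.id) fun ⟨x, hx⟩ => not_isLift_id v₀ x hx).ne'⟩
  refine card_hom_cfi_eq fun φ => exists_isLift_of_connectedComponent fun K' => ?_
  by_contra hK'
  refine hF' K' (containsCycleStructure_of_not_isLift (φ.comp K'.toSimpleGraph_hom) K hK
    fun v hv hx => hK' ?_)
  exact (K.reachable_of_mem_supp hv hv₀).exists_isLift_single hx

/-- The graphs without a cycle of length at least `l` and of the parity of `l` (without such an
induced cycle if `c = 1`) are homomorphism distinguishing closed. -/
theorem isHomDistinguishingClosed_cycle (c : Fin 2) (l : ℕ) :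
    IsHomDistinguishingClosed {F | ∀ (v : F.V) (C : F.graph.Walk v v), C.IsCycle → l ≤ C.length →
      C.length ≡ l [MOD 2] → ¬ (c = 1 → C.IsChordless)} := by
  -- For a one-vertex `R` a cycle structure is a single cycle.
  convert isHomDistinguishingClosed_cycleStructure (⊥ : SimpleGraph Unit) (fun _ => c) (fun _ => l)
    using 1
  ext F
  simp only [Set.mem_ofPred_eq]
  constructor
  · rintro h K ⟨x, C, hC, -, hlen, hch, -⟩
    refine h _ ((C ()).map K.toSimpleGraph_hom)
      ((Walk.isCycle_map_iff_of_injective K.toSimpleGraph_hom_injective).2 (hC ())) ?_ ?_ fun hc =>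
      (K.isChordless_map_iff _).2 (hch () hc)
    · rw [Walk.length_map]; exact (hlen ()).1
    · rw [Walk.length_map]; exact (hlen ()).2
  · intro h v C hC hl hp hch
    obtain ⟨K, u, q, rfl, rfl⟩ := C.exists_connectedComponent_walk
    rw [Walk.copy_rfl_rfl] at hC hl hp hch
    rw [Walk.length_map] at hl hp
    refine h K ⟨fun _ => u, fun _ => q, fun _ => ?_, fun a b hab => absurd rfl hab,
      fun _ => ⟨hl, hp⟩, fun _ hc => (K.isChordless_map_iff _).1 (hch hc), by simp⟩
    exact (Walk.isCycle_map_iff_of_injective K.toSimpleGraph_hom_injective).1 hC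

/-- The graphs without cycles of length at least `l` are homomorphism distinguishing closed. -/
theorem isHomDistinguishingClosed_cycle_length (l : ℕ) : IsHomDistinguishingClosed
    {F | ∀ (v : F.V) (C : F.graph.Walk v v), C.IsCycle → ¬ l ≤ C.length} := by
  -- The minimal lengths `l` and `l + 1` cover both parities.
  convert isHomDistinguishingClosed_inter (isHomDistinguishingClosed_cycle 0 l)
    (isHomDistinguishingClosed_cycle 0 (l + 1)) using 1
  ext F
  simp only [Set.mem_ofPred_eq, Set.mem_inter_iff, zero_ne_one, false_imp_iff, not_true_eq_false,
    imp_false, Nat.ModEq]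
  constructor
  · exact fun h => ⟨fun v C hC hl => absurd hl (h v C hC),
      fun v C hC hl => absurd (by omega) (h v C hC)⟩
  · rintro ⟨h1, h2⟩ v C hC hl
    have h1 := h1 v C hC hl
    have h2 := h2 v C hC (by omega)
    omega

end FinGraph

theorem corollary6p5 :
    (∀ (W : Type*) [Finite W] (R : SimpleGraph W) (c : W → Fin 2) (ℓ : W → ℕ), (∀ u, 3 ≤ ℓ u) →
      FinGraph.IsHomDistinguishingClosed
        {F | ∀ K : F.graph.ConnectedComponent,
          ¬ ContainsCycleStructure K.toSimpleGraph R c ℓ}) ∧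
    (∀ k : ℕ, 3 ≤ k →
      FinGraph.IsHomDistinguishingClosed {F | circumference F.graph ≤ k}) ∧
    FinGraph.IsHomDistinguishingClosed {F | F.graph.IsAcyclic} ∧
    FinGraph.IsHomDistinguishingClosed {F | ¬ HasOddHole F.graph} := by
  refine ⟨fun W _ R c ℓ _ => FinGraph.isHomDistinguishingClosed_cycleStructure R c ℓ,
    fun k _ => ?_, ?_, ?_⟩
  · convert FinGraph.isHomDistinguishingClosed_cycle_length (k + 1) using 1
    ext F
    simp only [Set.mem_ofPred_eq, circumference, iSup_le_iff, Nat.cast_le, Nat.succ_le_iff, not_lt]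
  · convert FinGraph.isHomDistinguishingClosed_cycle_length 3 using 1
    ext F
    exact ⟨fun h v C hC => absurd hC (h C), fun h v C hC => h v C hC hC.three_le_length⟩
  · convert FinGraph.isHomDistinguishingClosed_cycle 1 5 using 1
    ext F
    simp only [Set.mem_ofPred_eq, HasOddHole, not_exists, not_and, true_imp_iff, Nat.odd_iff]
    rfl
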